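/- Let $(W,S)$ be a Coxeter system with $S$ finite. For $I\subseteq S$ let $W_I$ be the subgroup of $W$ generated by $I$; the subgroups $wW_Iw^{-1}$ with $w\in W$, $I\subseteq S$ are called parabolic. (1) Let $I,J\subseteq S$ and $w\in W$ be such that $W_I\not\subseteq wW_Jw^{-1}$ and $wW_Jw^{-1}\not\subseteq W_I$. Then there are $x\in W$ and $K\subseteq S$ with $W_I\cap wW_Jw^{-1}=xW_Kx^{-1}$, and every such pair $(x,K)$ satisfies $|K|<\min\{|I|,|J|\}$. (2) Let $I,K\subseteq S$ and $x\in W$ be such that $xW_Kx^{-1}\subseteq W_I$. Then $|K|\le|I|$, and if moreover $xW_Kx^{-1}\ne W_I$, then $|K|<|I|$. -/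

import Mathlib

namespace CoxeterSystem

/-- The special subgroup `W_I` of the Coxeter system `(W, S)`, for `I ⊆ S`: the subgroup of `W`
generated by the simple reflections in `I`. Here `S` is indexed by `B`. -/
def specialSubgroup {B W : Type*} [Group W] {M : CoxeterMatrix B} (cs : CoxeterSystem M W)
    (I : Set B) : Subgroup W :=
  Subgroup.closure (cs.simple '' I)

/-- The parabolic subgroup `w W_I w⁻¹` of the Coxeter system `(W, S)`. -/
def parabolicSubgroup {B W : Type*} [Group W] {M : CoxeterMatrix B} (cs : CoxeterSystem M W)
    (w : W) (I : Set B) : Subgroup W :=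
  (cs.specialSubgroup I).map (MulAut.conj w).toMonoidHom

end CoxeterSystem

/-!
The minimal double coset representatives carry the proof. If `d` has minimal length both in
`W_I * d` and in `d * W_J`, then lengths add up in these two cosets
(`length_mul_of_forall_length_le`). Consequently an element of `W_I` that `d⁻¹` conjugates into
`W_J` keeps its length, and simple reflections correspond to simple reflections.

* `specialSubgroup_inf_parabolicSubgroup`: for such `d`, the intersection `W_I ∩ d W_J d⁻¹` is the
  special subgroup generated by those `s i`, `i ∈ I`, with `d⁻¹ s_i d` simple in `J`. Writing an
  arbitrary `w` as `a * d * b` with `a ∈ W_I` and `b ∈ W_J` shows that `W_I ∩ w W_J w⁻¹` is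
  parabolic.
* `exists_parabolicSubgroup_eq_of_le`: if `x W_K x⁻¹ ≤ W_I` and `x = a * d * b` is such a
  decomposition for the pair `(I, K)`, then conjugation by `d` embeds `K` into `I` with some image
  `L`, so `|K| = |L| ≤ |I|` and `x W_K x⁻¹ = a W_L a⁻¹`. If `|K| = |I|`, then `L = I` and the
  inclusion is an equality. The strict bounds for intersections follow, since under the
  non-inclusion hypotheses the intersection is a proper subgroup of both sides.

Two facts about Coxeter systems are needed. The deletion condition (`exists_isReduced_sublist`)
comes from the exchange condition, which is proved through the action of `W` on `W × ℤ/2` by signed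
conjugation. The simple reflections are distinct (`simple_injective`), so that counting elements of
`K` and `I` is the same as counting reflections; this comes from the geometric representation.
-/

namespace CoxeterSystem

open List

variable {B W : Type*} [Group W] {M : CoxeterMatrix B} (cs : CoxeterSystem M W)

/-! ### The exchange condition -/

open scoped Classical in
/-- The action of the simple reflection `s i` on pairs of an element of `W` and a sign, the sign
being written additively: it conjugates the element by `s i` and flips the sign of `s i` itself.
The first component ranges over all of `W` rather than only over the reflections. -/
noncomputable def signedConj (i : B) : Function.End (W × ZMod 2) :=
  fun p ↦ (cs.simple i * p.1 * cs.simple i, p.2 + if p.1 = cs.simple i then 1 else 0)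

lemma conj_pow_eq_simple_mul_pow_iff (i j : B) (n e : ℕ) (t : W) :
    (cs.simple i * cs.simple j) ^ n * t * ((cs.simple i * cs.simple j) ^ n)⁻¹ =
        cs.simple j * (cs.simple i * cs.simple j) ^ e ↔
      t = cs.simple j * (cs.simple i * cs.simple j) ^ (2 * n + e) := by
  set p := cs.simple i * cs.simple j with hp
  have h : SemiconjBy (cs.simple j) p p⁻¹ := by
    simp [SemiconjBy, hp, mul_assoc]
  have h' : cs.simple j * p ^ n = (p ^ n)⁻¹ * cs.simple j := by
    rw [(h.pow_right n).eq, inv_pow]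
  rw [mul_inv_eq_iff_eq_mul, ← eq_inv_mul_iff_mul_eq, mul_assoc, ← mul_assoc, ← h', mul_assoc,
    ← pow_add, ← pow_add, show n + (e + n) = 2 * n + e by ring]

lemma signedConj_mul_pow_apply [DecidableEq W] (i j : B) (n : ℕ) (t : W) (ε : ZMod 2) :
    ((cs.signedConj i * cs.signedConj j) ^ n) (t, ε) =
      ((cs.simple i * cs.simple j) ^ n * t * ((cs.simple i * cs.simple j) ^ n)⁻¹,
        ε + ∑ k ∈ Finset.range (2 * n),
          if t = cs.simple j * (cs.simple i * cs.simple j) ^ k then 1 else 0) := by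
  induction n with
  | zero => simp [Function.End.one_def]
  | succ n ih =>
    rw [pow_succ']
    change cs.signedConj i (cs.signedConj j (((cs.signedConj i * cs.signedConj j) ^ n) (t, ε))) = _
    rw [ih, mul_add_one, Finset.sum_range_succ, Finset.sum_range_succ]
    have h0 := cs.conj_pow_eq_simple_mul_pow_iff i j n 0 t
    have h1 := cs.conj_pow_eq_simple_mul_pow_iff i j n 1 t
    set p := cs.simple i * cs.simple j with hp
    rw [pow_zero, mul_one, add_zero] at h0
    have h2 : cs.simple j * (p ^ n * t * (p ^ n)⁻¹) * cs.simple j = cs.simple i ↔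
        t = cs.simple j * p ^ (2 * n + 1) := by
      rw [← h1, pow_one, hp, ← mul_left_inj (cs.simple j), ← mul_right_inj (cs.simple j)]
      simp [mul_assoc]
    simp only [signedConj, h0, h2]
    refine Prod.ext ?_ ?_
    · simp only [pow_succ' p n, mul_inv_rev]
      simp [hp, mul_assoc]
    · simp only [add_assoc]

/-- The signed conjugations satisfy the Coxeter relations: for `p = s i * s j` and `m = M i j` the
sign of `t` is flipped once for each `k < 2 * m` with `t = s j * p ^ k`, and since `p ^ m = 1`
these `k` come in pairs. -/
lemma isLiftable_signedConj : M.IsLiftable cs.signedConj := by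
  classical
  intro i j
  funext ⟨t, ε⟩
  rw [signedConj_mul_pow_apply, cs.simple_mul_simple_pow, two_mul, Finset.sum_range_add]
  simp only [pow_add, cs.simple_mul_simple_pow, one_mul, inv_one, mul_one, CharTwo.add_self_eq_zero,
    add_zero, Function.End.one_def, id]

/-- The parity of the number of occurrences of `t` in the right inversion sequence of a word
depends only on the product of the word. -/
lemma count_rightInvSeq_eq [DecidableEq W] {ω ω' : List B} (h : cs.wordProd ω = cs.wordProd ω')
    (t : W) : ((cs.rightInvSeq ω).count t : ZMod 2) = (cs.rightInvSeq ω').count t := by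
  have key (ω : List B) : cs.lift ⟨_, cs.isLiftable_signedConj⟩ (cs.wordProd ω) (t, 0) =
      (cs.wordProd ω * t * (cs.wordProd ω)⁻¹, ((cs.rightInvSeq ω).count t : ZMod 2)) := by
    induction ω with
    | nil => simp [Function.End.one_def]
    | cons i ω ih =>
      rw [cs.wordProd_cons, map_mul, cs.lift_apply_simple]
      change cs.signedConj i (cs.lift ⟨_, cs.isLiftable_signedConj⟩ (cs.wordProd ω) (t, 0)) = _
      rw [ih]
      have h1 : cs.wordProd ω * t * (cs.wordProd ω)⁻¹ = cs.simple i ↔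
          (cs.wordProd ω)⁻¹ * cs.simple i * cs.wordProd ω = t := by
        rw [mul_inv_eq_iff_eq_mul, ← eq_inv_mul_iff_mul_eq, mul_assoc, eq_comm]
      simp only [signedConj, rightInvSeq, count_cons, h1, beq_iff_eq]
      refine Prod.ext (by simp [mul_assoc]) ?_
      push_cast
      congr!
  simpa using congrArg Prod.snd ((key ω).symm.trans (h ▸ key ω'))

lemma simple_mem_rightInvSeq {ω : List B} {i : B} (h : cs.IsRightDescent (cs.wordProd ω) i) :
    cs.simple i ∈ cs.rightInvSeq ω := by
  classical
  obtain ⟨ω', hω', h'⟩ := cs.exists_isReduced (cs.wordProd ω * cs.simple i)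
  have hp : cs.wordProd ω = cs.wordProd (ω'.concat i) := by
    rw [wordProd_concat, ← h', simple_mul_simple_cancel_right]
  have hr : cs.IsReduced (ω'.concat i) := by
    have := cs.isRightDescent_iff.1 h
    rw [IsReduced, ← hp, ← this, h', hω'.eq, length_concat]
  have hmem : cs.simple i ∈ cs.rightInvSeq (ω'.concat i) := by
    rw [rightInvSeq_concat]
    simp
  have h1 := count_eq_one_of_mem hr.nodup_rightInvSeq hmem
  have h2 := cs.count_rightInvSeq_eq hp (cs.simple i)
  rw [h1] at h2
  by_contra hn
  rw [count_eq_zero_of_not_mem hn] at h2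
  simp at h2

/-- The exchange condition. -/
lemma exists_simple_mul_wordProd_eq_eraseIdx {ω : List B} {i : B}
    (h : cs.IsLeftDescent (cs.wordProd ω) i) :
    ∃ k < ω.length, cs.simple i * cs.wordProd ω = cs.wordProd (ω.eraseIdx k) := by
  have h1 : cs.IsRightDescent (cs.wordProd ω.reverse) i := by
    rwa [wordProd_reverse, isRightDescent_inv_iff]
  have h2 := cs.simple_mem_rightInvSeq h1
  rw [rightInvSeq_reverse, mem_reverse] at h2
  obtain ⟨k, hk, h3⟩ := mem_iff_getElem.1 h2
  refine ⟨k, by simpa using hk, ?_⟩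
  rw [← h3, ← getD_leftInvSeq_mul_wordProd, getD_eq_getElem _ _ hk]

/-- The deletion condition: deleting letters turns any word into a reduced word with the same
product. -/
lemma exists_isReduced_sublist (ω : List B) :
    ∃ ω', ω' <+ ω ∧ cs.IsReduced ω' ∧ cs.wordProd ω' = cs.wordProd ω := by
  induction ω with
  | nil => exact ⟨[], .refl _, by simp [IsReduced], rfl⟩
  | cons i ω ih =>
    obtain ⟨ω', hs, hr, hp⟩ := ih
    by_cases h : cs.IsLeftDescent (cs.wordProd ω') i
    · obtain ⟨k, hk, h1⟩ := cs.exists_simple_mul_wordProd_eq_eraseIdx h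
      refine ⟨ω'.eraseIdx k, ((eraseIdx_sublist _ _).trans hs).cons _, ?_, ?_⟩
      · have := cs.isLeftDescent_iff.1 h
        have h2 := length_eraseIdx_add_one hk
        rw [hr.eq, h1] at this
        rw [IsReduced]
        lia
      · rw [wordProd_cons, ← hp, h1]
    · refine ⟨i :: ω', hs.cons_cons _, ?_, by rw [wordProd_cons, wordProd_cons, hp]⟩
      rw [IsReduced, wordProd_cons, cs.not_isLeftDescent_iff.1 h, hr.eq, length_cons]

end CoxeterSystem

/-! ### The simple reflections are distinct -/

open Module in
/-- If `f y = g x = -(η + η⁻¹)`, then the product of the reflections defined by `(x, f)` and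
`(y, g)` acts on the span of `x` and `y` with the eigenvectors `x + η⁻¹ y` and `x + η y`, of
eigenvalues `η ^ 2` and `η ^ (-2)`. -/
lemma preReflection_mul_preReflection_pow_eq_one {V : Type*} [AddCommGroup V] [Module ℂ V]
    {x y : V} {f g : Dual ℂ V} {η : ℂ} {m : ℕ} (hm : 1 < m) (hη : IsPrimitiveRoot (η ^ 2) m)
    (hfx : f x = 2) (hgy : g y = 2) (hfy : f y = -(η + η⁻¹)) (hgx : g x = -(η + η⁻¹)) :
    (preReflection x f * preReflection y g) ^ m = 1 := by
  have h0 : η ≠ 0 := by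
    rintro rfl
    exact hη.ne_zero (by lia) (by simp)
  set p := preReflection x f * preReflection y g with hp
  have hpz (z : V) : p z = z - g z • y - (f z - g z * f y) • x := by
    simp [hp, preReflection_apply]
  set N := ∑ k ∈ Finset.range m, p ^ k with hN
  have eig {v : V} {ζ : ℂ} (hζ : IsPrimitiveRoot ζ m) (hv : p v = ζ • v) : N v = 0 := by
    have hk (k : ℕ) : (p ^ k) v = ζ ^ k • v := by
      induction k with
      | zero => simp
      | succ k ih => rw [pow_succ', Module.End.mul_apply, ih, map_smul, hv, smul_smul, pow_succ]
    rw [hN, LinearMap.sum_apply]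
    simp only [hk]
    rw [← Finset.sum_smul, hζ.geom_sum_eq_zero hm, zero_smul]
  have h1 : N (x + η⁻¹ • y) = 0 := by
    refine eig hη ?_
    rw [hpz]
    simp only [map_add, map_smul, hfx, hgy, hfy, hgx, smul_eq_mul]
    match_scalars <;> field_simp <;> ring
  have h2 : N (x + η • y) = 0 := by
    refine eig hη.inv ?_
    rw [hpz]
    simp only [map_add, map_smul, hfx, hgy, hfy, hgx, smul_eq_mul]
    match_scalars <;> field_simp <;> ring
  have hy : N y = 0 := by
    have h3 : (η - η⁻¹) • N y = 0 := by
      rw [← map_smul]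
      have : (η - η⁻¹) • y = (x + η • y) - (x + η⁻¹ • y) := by module
      rw [this, map_sub, h1, h2, sub_zero]
    refine (smul_eq_zero.1 h3).resolve_left fun h4 ↦ hη.ne_one hm ?_
    field_simp at h4
    linear_combination h4
  have hx : N x = 0 := by simpa [hy] using h1
  have hNp : N * (p - 1) = 0 := by
    ext z
    have : (p - 1) z = -(g z • y) - (f z - g z * f y) • x := by
      rw [LinearMap.sub_apply, hpz, Module.End.one_apply]; abel
    rw [Module.End.mul_apply, this]
    simp [hx, hy]
  rw [hN, geom_sum_mul] at hNp
  exact sub_eq_zero.1 hNp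

namespace CoxeterSystem

variable {B W : Type*} [Group W] {M : CoxeterMatrix B} (cs : CoxeterSystem M W)

open Module in
/-- The geometric representation, acting on functions `B → ℂ`, shows that the simple reflections
of a Coxeter system are distinct. -/
theorem simple_injective : Function.Injective cs.simple := by
  classical
  -- The diagonal entries are `-2 * cos π = 2`; an entry `M i k = 0` gives `-2 * cos 0 = -2`,
  -- since division by zero yields zero.
  let η (i k : B) : ℂ := Complex.exp (Real.pi * Complex.I / M i k)
  let a (i k : B) : ℂ := -(η i k + (η i k)⁻¹)
  have haii (i : B) : a i i = 2 := by
    simp only [a, η, M.diagonal, Nat.cast_one, div_one, Complex.exp_pi_mul_I]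
    norm_num
  let σ (i : B) : End ℂ (B → ℂ) := preReflection (a i) (LinearMap.proj i)
  have hσ : M.IsLiftable σ := by
    intro i j
    rcases eq_or_ne i j with rfl | hij
    · rw [M.diagonal, pow_one]
      ext1 z
      exact involutive_preReflection (f := LinearMap.proj i) (x := a i) (haii i) z
    · have h1 : M i j ≠ 1 := M.off_diagonal i j hij
      rcases Nat.eq_zero_or_pos (M i j) with h0 | hpos
      · rw [h0, pow_zero]
      · refine preReflection_mul_preReflection_pow_eq_one (η := η i j) (by lia) ?_
          (haii i) (haii j) ?_ rfl
        · have := Complex.isPrimitiveRoot_exp (M i j) (by lia)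
          convert this using 1
          rw [← Complex.exp_nat_mul]
          congr 1
          push_cast
          ring
        · simp only [LinearMap.proj_apply, a, η, M.symmetric j i]
  intro i j h
  by_contra hij
  have h1 : σ i = σ j := by
    rw [← cs.lift_apply_simple hσ i, ← cs.lift_apply_simple hσ j, h]
  have h2 := congrFun (LinearMap.congr_fun h1 (Pi.single i 1)) i
  simp only [σ, preReflection_apply, LinearMap.proj_apply, Pi.sub_apply, Pi.smul_apply, haii,
    Pi.single_eq_same, Pi.single_eq_of_ne (Ne.symm hij), zero_smul, smul_eq_mul] at h2
  norm_num at h2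

end CoxeterSystem

namespace CoxeterSystem

open List

variable {B W : Type*} [Group W] {M : CoxeterMatrix B} (cs : CoxeterSystem M W)

/-! ### Special subgroups -/

lemma simple_mem_specialSubgroup {I : Set B} {i : B} (hi : i ∈ I) :
    cs.simple i ∈ cs.specialSubgroup I :=
  Subgroup.subset_closure ⟨i, hi, rfl⟩

lemma wordProd_mem_specialSubgroup {I : Set B} {ω : List B} (h : ∀ i ∈ ω, i ∈ I) :
    cs.wordProd ω ∈ cs.specialSubgroup I :=
  Subgroup.list_prod_mem _ <| by
    simpa using fun i hi ↦ cs.simple_mem_specialSubgroup (h i hi)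

lemma exists_isReduced_of_mem_specialSubgroup {I : Set B} {w : W}
    (hw : w ∈ cs.specialSubgroup I) :
    ∃ ω, (∀ i ∈ ω, i ∈ I) ∧ cs.IsReduced ω ∧ cs.wordProd ω = w := by
  suffices h : ∃ ω, (∀ i ∈ ω, i ∈ I) ∧ cs.wordProd ω = w by
    obtain ⟨ω, h, rfl⟩ := h
    obtain ⟨ω', hs, hr, hp⟩ := cs.exists_isReduced_sublist ω
    exact ⟨ω', fun i hi ↦ h i (hs.subset hi), hr, hp⟩
  induction hw using Subgroup.closure_induction with
  | mem x hx =>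
    obtain ⟨i, hi, rfl⟩ := hx
    exact ⟨[i], by simpa using hi, by simp⟩
  | one => exact ⟨[], by simp, by simp⟩
  | mul x y _ _ hx hy =>
    obtain ⟨ω, h, rfl⟩ := hx
    obtain ⟨ω', h', rfl⟩ := hy
    exact ⟨ω ++ ω', by grind, cs.wordProd_append _ _⟩
  | inv x _ hx =>
    obtain ⟨ω, h, rfl⟩ := hx
    exact ⟨ω.reverse, by simpa using h, cs.wordProd_reverse _⟩

lemma exists_eq_simple_of_mem_specialSubgroup {I : Set B} {w : W}
    (hw : w ∈ cs.specialSubgroup I) (h1 : cs.length w = 1) : ∃ i ∈ I, w = cs.simple i := by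
  obtain ⟨ω, hI, hr, rfl⟩ := cs.exists_isReduced_of_mem_specialSubgroup hw
  obtain ⟨i, rfl⟩ := List.length_eq_one_iff.1 (hr.eq ▸ h1)
  exact ⟨i, hI i (by simp), by simp⟩

/-- Lengths add up in `W_I * d` when `d` has minimal length in this coset: deleting letters from a
word for `u * d` cannot remove any letter of `d`, hence none of `u` either. -/
lemma length_mul_of_forall_length_le {I : Set B} {d u : W}
    (hd : ∀ v ∈ cs.specialSubgroup I, cs.length d ≤ cs.length (v * d))
    (hu : u ∈ cs.specialSubgroup I) :
    cs.length (u * d) = cs.length u + cs.length d := by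
  obtain ⟨ω, hI, hr, rfl⟩ := cs.exists_isReduced_of_mem_specialSubgroup hu
  obtain ⟨δ, hδ, rfl⟩ := cs.exists_isReduced d
  obtain ⟨ω', hs, hr', hp⟩ := cs.exists_isReduced_sublist (ω ++ δ)
  obtain ⟨ω₁, δ₁, rfl, h₁, h₂⟩ := sublist_append_iff.1 hs
  have hω₁ := cs.wordProd_mem_specialSubgroup fun i hi ↦ hI i (h₁.subset hi)
  rw [wordProd_append, wordProd_append] at hp
  have h3 : cs.wordProd δ₁ = ((cs.wordProd ω₁)⁻¹ * cs.wordProd ω) * cs.wordProd δ := by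
    rw [mul_assoc, ← hp, inv_mul_cancel_left]
  have h4 := hd _ (mul_mem (inv_mem hω₁) hu)
  rw [← h3, hδ.eq] at h4
  obtain rfl := h₂.eq_of_length_le (h4.trans (cs.length_wordProd_le _))
  have h5 : cs.wordProd ω₁ = cs.wordProd ω := mul_right_cancel hp
  have h6 : ω.length ≤ ω₁.length := by
    rw [← hr.eq, ← h5]; exact cs.length_wordProd_le _
  obtain rfl := h₁.eq_of_length_le h6
  rw [← wordProd_append, hr'.eq, length_append, hr.eq, hδ.eq]

lemma length_mul_of_forall_length_le' {J : Set B} {d v : W}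
    (hd : ∀ u ∈ cs.specialSubgroup J, cs.length d ≤ cs.length (d * u))
    (hv : v ∈ cs.specialSubgroup J) :
    cs.length (d * v) = cs.length d + cs.length v := by
  have h := cs.length_mul_of_forall_length_le (d := d⁻¹) (u := v⁻¹) (I := J) (fun u hu ↦ by
    rw [← cs.length_inv (u * d⁻¹), length_inv, mul_inv_rev, inv_inv]
    exact hd _ (inv_mem hu)) (inv_mem hv)
  rw [← mul_inv_rev] at h
  simp only [length_inv] at h
  rw [h, add_comm]

/-- Every double coset `W_I * w * W_J` contains an element `d` of minimal length in both `W_I * d`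
and `d * W_J`. -/
lemma exists_eq_mul_mul_forall_length_le (I J : Set B) (w : W) :
    ∃ a ∈ cs.specialSubgroup I, ∃ b ∈ cs.specialSubgroup J, ∃ d, w = a * d * b ∧
      (∀ u ∈ cs.specialSubgroup I, cs.length d ≤ cs.length (u * d)) ∧
      ∀ u ∈ cs.specialSubgroup J, cs.length d ≤ cs.length (d * u) := by
  let S : Set W := {d | ∃ a ∈ cs.specialSubgroup I, ∃ b ∈ cs.specialSubgroup J, w = a * d * b}
  have hS : S.Nonempty := ⟨w, 1, one_mem _, 1, one_mem _, by simp⟩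
  obtain ⟨a, ha, b, hb, h⟩ := Function.argminOn_mem cs.length S hS
  refine ⟨a, ha, b, hb, _, h, fun u hu ↦ ?_, fun u hu ↦ ?_⟩
  · refine Function.argminOn_le cs.length S
      ⟨a * u⁻¹, mul_mem ha (inv_mem hu), b, hb, ?_⟩
    rw [h]; group
  · refine Function.argminOn_le cs.length S
      ⟨a, ha, u⁻¹ * b, mul_mem (inv_mem hu) hb, ?_⟩
    rw [h]; group

/-! ### Parabolic subgroups -/

lemma mem_parabolicSubgroup_iff {w g : W} {I : Set B} :
    g ∈ cs.parabolicSubgroup w I ↔ w⁻¹ * g * w ∈ cs.specialSubgroup I := by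
  rw [parabolicSubgroup, Subgroup.mem_map]
  constructor
  · rintro ⟨u, hu, rfl⟩
    simpa [mul_assoc] using hu
  · exact fun h ↦ ⟨_, h, by simp [mul_assoc]⟩

lemma conj_mem_specialSubgroup_iff {I : Set B} {a g : W} (ha : a ∈ cs.specialSubgroup I) :
    a⁻¹ * g * a ∈ cs.specialSubgroup I ↔ g ∈ cs.specialSubgroup I := by
  rw [Subgroup.mul_mem_cancel_right _ ha, Subgroup.mul_mem_cancel_left _ (inv_mem ha)]

lemma parabolicSubgroup_of_mem {I : Set B} {a : W} (ha : a ∈ cs.specialSubgroup I) :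
    cs.parabolicSubgroup a I = cs.specialSubgroup I := by
  ext g
  rw [mem_parabolicSubgroup_iff, cs.conj_mem_specialSubgroup_iff ha]

lemma mem_parabolicSubgroup_mul_mul_iff {J : Set B} {a b d g : W}
    (hb : b ∈ cs.specialSubgroup J) :
    g ∈ cs.parabolicSubgroup (a * d * b) J ↔ a⁻¹ * g * a ∈ cs.parabolicSubgroup d J := by
  rw [mem_parabolicSubgroup_iff, mem_parabolicSubgroup_iff,
    ← cs.conj_mem_specialSubgroup_iff (g := d⁻¹ * _ * d) hb]
  simp only [mul_inv_rev, mul_assoc]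

lemma mem_parabolicSubgroup_mul_iff {K : Set B} {x y g : W} :
    g ∈ cs.parabolicSubgroup (x * y) K ↔ x⁻¹ * g * x ∈ cs.parabolicSubgroup y K := by
  simp only [mem_parabolicSubgroup_iff, mul_inv_rev, mul_assoc]

/-- Let `d` be of minimal length in `W_I * d` and in `d * W_J`, and let `u ∈ W_I` with
`u * d = d * v`, `v ∈ W_J`. Moving the first letter `s i` of a reduced word for `u` across `d`
yields an element of `W_J`, which has length one because lengths add up in both cosets. -/
lemma specialSubgroup_inf_parabolicSubgroup {I J : Set B} {d : W}
    (hI : ∀ u ∈ cs.specialSubgroup I, cs.length d ≤ cs.length (u * d))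
    (hJ : ∀ u ∈ cs.specialSubgroup J, cs.length d ≤ cs.length (d * u)) :
    cs.specialSubgroup I ⊓ cs.parabolicSubgroup d J =
      cs.specialSubgroup {i ∈ I | ∃ j ∈ J, cs.simple i * d = d * cs.simple j} := by
  set K : Set B := {i ∈ I | ∃ j ∈ J, cs.simple i * d = d * cs.simple j}
  apply le_antisymm
  · intro u hu
    rw [Subgroup.mem_inf] at hu
    obtain ⟨hu, hu'⟩ := hu
    obtain ⟨ω, hω, hr, rfl⟩ := cs.exists_isReduced_of_mem_specialSubgroup hu
    clear hu
    induction ω with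
    | nil => simp
    | cons i ω ih =>
      simp only [mem_cons, forall_eq_or_imp] at hω
      have hrω : cs.IsReduced ω := hr.drop 1
      have hωI := cs.wordProd_mem_specialSubgroup hω.2
      have hiI := cs.simple_mem_specialSubgroup hω.1
      rw [mem_parabolicSubgroup_iff] at hu'
      set v := d⁻¹ * cs.wordProd (i :: ω) * d with hv
      have hdv : d * v = cs.simple i * cs.wordProd ω * d := by
        rw [hv, wordProd_cons]; group
      have hdesc : cs.IsLeftDescent (d * v) i := by
        rw [IsLeftDescent, hdv, mul_assoc (cs.simple i), simple_mul_simple_cancel_left,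
          cs.length_mul_of_forall_length_le hI hωI, ← mul_assoc,
          cs.length_mul_of_forall_length_le hI (mul_mem hiI hωI), ← wordProd_cons, hr.eq, hrω.eq,
          length_cons]
        lia
      have hmin : cs.length (cs.simple i * d) = 1 + cs.length d := by
        rw [cs.length_mul_of_forall_length_le hI hiI, length_simple]
      -- The exchange condition deletes a letter from a reduced word for `d` or from one for `v`.
      obtain ⟨z, hz, hzd⟩ : ∃ z ∈ cs.specialSubgroup J, cs.simple i * d = d * z := by
        obtain ⟨ν, hν, -, hν'⟩ := cs.exists_isReduced_of_mem_specialSubgroup hu'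
        obtain ⟨δ, hδ, hδ'⟩ := cs.exists_isReduced d
        rw [← hν', hδ', ← wordProd_append] at hdesc
        obtain ⟨k, hk, he⟩ := cs.exists_simple_mul_wordProd_eq_eraseIdx hdesc
        rcases lt_or_ge k δ.length with hkδ | hkδ
        · rw [eraseIdx_append_of_lt_length hkδ, wordProd_append, wordProd_append, ← mul_assoc,
            mul_left_inj, ← hδ'] at he
          have h1 := cs.length_wordProd_le (δ.eraseIdx k)
          have h2 := length_eraseIdx_add_one hkδ
          rw [← he, hmin, hδ', hδ.eq] at h1
          lia
        · rw [eraseIdx_append_of_length_le hkδ, wordProd_append, wordProd_append, ← hδ', hν'] at he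
          refine ⟨cs.wordProd (ν.eraseIdx (k - δ.length)) * v⁻¹,
            mul_mem (cs.wordProd_mem_specialSubgroup fun j hj ↦
              hν j (mem_of_mem_eraseIdx hj)) (inv_mem hu'), ?_⟩
          rw [← mul_assoc, ← he]; group
      have hz1 : cs.length z = 1 := by
        have := cs.length_mul_of_forall_length_le' hJ hz
        rw [← hzd, hmin] at this
        lia
      obtain ⟨j, hj, rfl⟩ := cs.exists_eq_simple_of_mem_specialSubgroup hz hz1
      rw [wordProd_cons]
      refine mul_mem (cs.simple_mem_specialSubgroup ⟨hω.1, j, hj, hzd⟩) (ih hω.2 hrω ?_)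
      rw [mem_parabolicSubgroup_iff]
      have : d⁻¹ * cs.wordProd ω * d = cs.simple j * v := by
        rw [← mul_right_inj d, ← mul_assoc d (cs.simple j), ← hzd, mul_assoc (cs.simple i), hdv,
          mul_assoc (cs.simple i), simple_mul_simple_cancel_left]
        group
      rw [this]
      exact mul_mem (cs.simple_mem_specialSubgroup hj) hu'
  · rw [specialSubgroup, Subgroup.closure_le]
    rintro _ ⟨i, ⟨hi, j, hj, h⟩, rfl⟩
    refine Subgroup.mem_inf.2 ⟨cs.simple_mem_specialSubgroup hi, ?_⟩
    rw [mem_parabolicSubgroup_iff, mul_assoc, h, inv_mul_cancel_left]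
    exact cs.simple_mem_specialSubgroup hj

theorem exists_specialSubgroup_inf_parabolicSubgroup_eq (I J : Set B) (w : W) :
    ∃ x, ∃ K ⊆ I, cs.specialSubgroup I ⊓ cs.parabolicSubgroup w J = cs.parabolicSubgroup x K := by
  obtain ⟨a, ha, b, hb, d, rfl, hI, hJ⟩ := cs.exists_eq_mul_mul_forall_length_le I J w
  refine ⟨a, {i ∈ I | ∃ j ∈ J, cs.simple i * d = d * cs.simple j}, Set.sep_subset _ _, ?_⟩
  ext g
  rw [mem_parabolicSubgroup_iff, ← cs.specialSubgroup_inf_parabolicSubgroup hI hJ,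
    Subgroup.mem_inf, Subgroup.mem_inf, cs.mem_parabolicSubgroup_mul_mul_iff hb,
    cs.conj_mem_specialSubgroup_iff ha]

/-- A parabolic subgroup contained in `W_I` is conjugate, by an element of `W_I`, to a special
subgroup `W_L` of the same rank with `L ⊆ I`. For a double coset representative `d` of minimal
length with `d * W_K * d⁻¹ ≤ W_I`, the elements `d * s k * d⁻¹` of `W_I` have length one. -/
theorem exists_parabolicSubgroup_eq_of_le {I K : Finset B} {x : W}
    (h : cs.parabolicSubgroup x (K : Set B) ≤ cs.specialSubgroup (I : Set B)) :
    ∃ a ∈ cs.specialSubgroup (I : Set B), ∃ L ⊆ I, L.card = K.card ∧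
      cs.parabolicSubgroup x (K : Set B) = cs.parabolicSubgroup a (L : Set B) := by
  classical
  obtain ⟨a, ha, b, hb, d, rfl, hI, hK⟩ := cs.exists_eq_mul_mul_forall_length_le (I : Set B) K x
  have hs : ∀ k ∈ K, ∃ i ∈ I, d * cs.simple k * d⁻¹ = cs.simple i := by
    intro k hk
    have hkK := cs.simple_mem_specialSubgroup (I := (K : Set B)) hk
    have hmem : d * cs.simple k * d⁻¹ ∈ cs.specialSubgroup (I : Set B) := by
      have := @h (a * (d * cs.simple k * d⁻¹) * a⁻¹) (by
        rw [cs.mem_parabolicSubgroup_mul_mul_iff hb, mem_parabolicSubgroup_iff]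
        simpa [mul_assoc] using hkK)
      rw [← cs.conj_mem_specialSubgroup_iff ha] at this
      simpa [mul_assoc] using this
    refine cs.exists_eq_simple_of_mem_specialSubgroup hmem ?_
    have h1 := cs.length_mul_of_forall_length_le hI hmem
    rw [inv_mul_cancel_right, cs.length_mul_of_forall_length_le' hK hkK, length_simple] at h1
    lia
  choose! f hfI hf using hs
  refine ⟨a, ha, K.image f, Finset.image_subset_iff.2 hfI, Finset.card_image_of_injOn ?_, ?_⟩
  · intro k hk l hl hkl
    have : d * cs.simple k * d⁻¹ = d * cs.simple l * d⁻¹ := by rw [hf k hk, hf l hl, hkl]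
    exact cs.simple_injective (mul_left_cancel (mul_right_cancel this))
  · have hd : cs.parabolicSubgroup d (K : Set B) =
        cs.specialSubgroup ((K.image f : Finset B) : Set B) := by
      rw [parabolicSubgroup, specialSubgroup, specialSubgroup, MonoidHom.map_closure,
        Finset.coe_image, Set.image_image, Set.image_image]
      congr 1
      exact Set.image_congr fun k hk ↦ by simpa using hf k hk
    ext g
    rw [cs.mem_parabolicSubgroup_mul_mul_iff hb, hd, mem_parabolicSubgroup_iff]

theorem card_le_of_parabolicSubgroup_le {I K : Finset B} {x : W}
    (h : cs.parabolicSubgroup x (K : Set B) ≤ cs.specialSubgroup (I : Set B)) :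
    K.card ≤ I.card := by
  obtain ⟨a, -, L, hL, hc, -⟩ := cs.exists_parabolicSubgroup_eq_of_le h
  exact hc ▸ Finset.card_le_card hL

theorem card_lt_of_parabolicSubgroup_lt {I K : Finset B} {x : W}
    (h : cs.parabolicSubgroup x (K : Set B) < cs.specialSubgroup (I : Set B)) :
    K.card < I.card := by
  obtain ⟨a, ha, L, hL, hc, he⟩ := cs.exists_parabolicSubgroup_eq_of_le h.le
  refine hc ▸ Finset.card_lt_card (hL.ssubset_of_ne ?_)
  rintro rfl
  exact h.ne (he.trans (cs.parabolicSubgroup_of_mem ha))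

end CoxeterSystem

theorem lemma3p3 {B W : Type*} [Finite B] [Group W] {M : CoxeterMatrix B}
    (cs : CoxeterSystem M W) :
    (∀ (I J : Finset B) (w : W),
      ¬ cs.specialSubgroup (I : Set B) ≤ cs.parabolicSubgroup w (J : Set B) →
      ¬ cs.parabolicSubgroup w (J : Set B) ≤ cs.specialSubgroup (I : Set B) →
        (∃ (x : W) (K : Finset B),
          cs.specialSubgroup (I : Set B) ⊓ cs.parabolicSubgroup w (J : Set B) =
            cs.parabolicSubgroup x (K : Set B)) ∧
        (∀ (x : W) (K : Finset B),
          cs.specialSubgroup (I : Set B) ⊓ cs.parabolicSubgroup w (J : Set B) =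
            cs.parabolicSubgroup x (K : Set B) →
          K.card < min I.card J.card)) ∧
    (∀ (I K : Finset B) (x : W),
      cs.parabolicSubgroup x (K : Set B) ≤ cs.specialSubgroup (I : Set B) →
        K.card ≤ I.card ∧
        (cs.parabolicSubgroup x (K : Set B) ≠ cs.specialSubgroup (I : Set B) →
          K.card < I.card)) := by
  refine ⟨fun I J w hIJ hJI ↦ ⟨?_, fun x K h ↦ ?_⟩, fun I K x h ↦
    ⟨cs.card_le_of_parabolicSubgroup_le h, fun hne ↦
      cs.card_lt_of_parabolicSubgroup_lt (lt_of_le_of_ne h hne)⟩⟩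
  · obtain ⟨x, K, hK, h⟩ := cs.exists_specialSubgroup_inf_parabolicSubgroup_eq I J w
    refine ⟨x, (I.finite_toSet.subset hK).toFinset, ?_⟩
    rwa [Set.Finite.coe_toFinset]
  · refine lt_min (cs.card_lt_of_parabolicSubgroup_lt (x := x) ?_)
      (cs.card_lt_of_parabolicSubgroup_lt (x := w⁻¹ * x) ?_)
    · exact h ▸ inf_lt_left.2 hIJ
    -- Conjugating by `w⁻¹` turns `x * W_K * x⁻¹ < w * W_J * w⁻¹` into a strict inclusion in `W_J`.
    · have hlt : cs.parabolicSubgroup x (K : Set B) < cs.parabolicSubgroup w (J : Set B) :=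
        h ▸ inf_lt_right.2 hJI
      rw [lt_iff_le_not_ge] at hlt ⊢
      refine ⟨fun g hg ↦ ?_, fun hle ↦ hlt.2 fun g hg ↦ ?_⟩
      · rw [cs.mem_parabolicSubgroup_mul_iff] at hg
        have := cs.mem_parabolicSubgroup_iff.1 (hlt.1 hg)
        simpa [mul_assoc] using this
      · have := hle (cs.mem_parabolicSubgroup_iff.1 hg)
        rw [cs.mem_parabolicSubgroup_mul_iff] at this
        simpa [mul_assoc] using this
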